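/- Let $C = 1 + \frac{\pi^2-4}{\pi^2+4} = 1.4231\ldots$. Let $G$ be a finite simple graph with $m$ edges and clique number $\omega(G)$, and let $\lambda_1 \ge \lambda_2 \ge \dots \ge \lambda_n$ be the eigenvalues of its adjacency matrix, counted with multiplicity. If $G$ is not a complete graph (so that in particular $n \ge 2$), then $$\lambda_1^2 + \lambda_2^2 \le \left(1 - \frac{1}{C\,\omega(G)}\right) 2m.$$ -/

import Mathlib

namespace SimpleGraph

theorem isHermitian_adjMatrix_real {V : Type*} (G : SimpleGraph V) [DecidableRel G.Adj] :
    (G.adjMatrix ℝ).IsHermitian := by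
  rw [Matrix.IsHermitian, Matrix.conjTranspose_eq_transpose_of_trivial]
  exact G.isSymm_adjMatrix

/-- The adjacency eigenvalues of a finite graph on `n` vertices, counted with multiplicity and
listed from largest to smallest; the index starts at `0`, so that the eigenvalue usually written
`λ₁` is `G.adjEigenvalue 0 _`, and `λ₂` is `G.adjEigenvalue 1 _`. -/
noncomputable def adjEigenvalue {V : Type*} [Fintype V] [DecidableEq V] (G : SimpleGraph V)
    [DecidableRel G.Adj] (k : ℕ) (hk : k < Fintype.card V) : ℝ :=
  G.isHermitian_adjMatrix_real.eigenvalues₀ ⟨k, hk⟩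

/-- A graph that is not complete has at least two vertices. -/
theorem one_lt_card_of_ne_top {V : Type*} [Fintype V] {G : SimpleGraph V} (hG : G ≠ ⊤) :
    1 < Fintype.card V := by
  by_contra h
  have : Subsingleton V := Fintype.card_le_one_iff_subsingleton.mp (not_lt.mp h)
  exact hG (Subsingleton.elim _ _)

end SimpleGraph

/-! ### Spectral expansion of quadratic forms -/

namespace Matrix.IsHermitian

variable {n : Type*} [Fintype n] [DecidableEq n] {A : Matrix n n ℝ}

/-! Since `G` is not complete, `λ₁, λ₂ ≥ 0`, so `M = λ₁xxᵀ + λ₂yyᵀ`, with orthonormal eigenvectors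
`x`, `y`, is a Gram matrix of plane vectors, and `⟨A, M⟩ = ‖M‖² = λ₁² + λ₂²`. Cauchy–Schwarz on the
edges gives `⟨A, M⟩² ≤ 2m ∑ A M²`, so it suffices that `∑ A M² ≤ (1 - c/ω) ∑ M²` with `c ≥ 1/C`
(`sum_adjMatrix_mul_gram_sq_le`). Doubling angles makes `M²` a linear kernel plus a product of
norms. Projecting on a direction and applying Motzkin–Straus to the positive and negative parts
bounds it. Averaging over all directions would give `1/C = 1/2 + 2/π² ≈ 0.703`; four directions 45°
apart already give `c = 0.72`. -/

theorem dotProduct_self_eq_sum_sq (hA : A.IsHermitian) (f : n → ℝ) :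
    f ⬝ᵥ f = ∑ k, (⇑(hA.eigenvectorBasis k) ⬝ᵥ f) ^ 2 := by
  have h := hA.eigenvectorBasis.sum_inner_mul_inner (WithLp.toLp 2 f) (WithLp.toLp 2 f)
  simp only [EuclideanSpace.inner_eq_star_dotProduct, star_trivial] at h
  rw [← h]
  refine Finset.sum_congr rfl fun k _ => ?_
  rw [sq, dotProduct_comm f]

theorem dotProduct_mulVec_eq_sum (hA : A.IsHermitian) (f : n → ℝ) :
    f ⬝ᵥ A *ᵥ f = ∑ k, hA.eigenvalues k * (⇑(hA.eigenvectorBasis k) ⬝ᵥ f) ^ 2 := by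
  have h := hA.eigenvectorBasis.sum_inner_mul_inner (WithLp.toLp 2 f) (WithLp.toLp 2 (A *ᵥ f))
  simp only [EuclideanSpace.inner_eq_star_dotProduct, star_trivial] at h
  rw [dotProduct_comm, ← h]
  refine Finset.sum_congr rfl fun k _ => ?_
  have hT : Aᵀ = A := by rw [← conjTranspose_eq_transpose_of_trivial, hA.eq]
  have hk : (A *ᵥ f) ⬝ᵥ ⇑(hA.eigenvectorBasis k) =
      hA.eigenvalues k * (⇑(hA.eigenvectorBasis k) ⬝ᵥ f) := by
    rw [dotProduct_comm, dotProduct_mulVec, ← mulVec_transpose, hT, hA.mulVec_eigenvectorBasis,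
      smul_dotProduct, smul_eq_mul]
  rw [hk]
  ring

theorem eigenvectorBasis_dotProduct (hA : A.IsHermitian) (i j : n) :
    ⇑(hA.eigenvectorBasis i) ⬝ᵥ ⇑(hA.eigenvectorBasis j) = if i = j then 1 else 0 := by
  have h := orthonormal_iff_ite.mp hA.eigenvectorBasis.orthonormal j i
  rw [EuclideanSpace.inner_eq_star_dotProduct, star_trivial] at h
  rw [h]
  simp only [eq_comm]

end Matrix.IsHermitian

/-! ### The Motzkin–Straus inequality -/

namespace SimpleGraph

open Matrix Finset

theorem one_le_cliqueNum {V : Type*} [Fintype V] (G : SimpleGraph V) [Nonempty V] : 1 ≤ G.cliqueNum := by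
  obtain ⟨v⟩ := ‹Nonempty V›
  have h : G.IsClique (({v} : Finset V) : Set V) := by simp
  simpa using h.card_le_cliqueNum

theorem sum_adjMatrix_eq_two_mul_card_edgeFinset {V : Type*} [Fintype V] (G : SimpleGraph V)
    [DecidableRel G.Adj] :
    ∑ i, ∑ j, G.adjMatrix ℝ i j = 2 * (#G.edgeFinset : ℝ) := by
  have h := G.sum_degrees_eq_twice_card_edges
  have h' : ((∑ v, G.degree v : ℕ) : ℝ) = 2 * (#G.edgeFinset : ℝ) := by rw [h]; push_cast; ring
  rw [← h', Nat.cast_sum]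
  refine sum_congr rfl fun i _ => ?_
  simp [adjMatrix_apply, ← card_neighborFinset_eq_degree, neighborFinset_eq_filter]

variable {V : Type*} [Fintype V] [DecidableEq V] (G : SimpleGraph V) [DecidableRel G.Adj]

/-- If the support of a nonnegative weight is a clique, its adjacency form is at most
`(1 - 1 / ω)` times the square of its total. -/
theorem dotProduct_adjMatrix_mulVec_le_of_isClique [Nonempty V] {w : V → ℝ}
    (hc : G.IsClique ({v | w v ≠ 0} : Finset V)) :
    w ⬝ᵥ G.adjMatrix ℝ *ᵥ w ≤ (1 - 1 / (G.cliqueNum : ℝ)) * (∑ v, w v) ^ 2 := by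
  set s : Finset V := {v | w v ≠ 0} with hs
  have hω : (1 : ℝ) ≤ G.cliqueNum := by exact_mod_cast G.one_le_cliqueNum
  have hform : w ⬝ᵥ G.adjMatrix ℝ *ᵥ w = (∑ v, w v) ^ 2 - ∑ v, w v ^ 2 := by
    rw [sq, sum_mul_sum, dotProduct, ← sum_sub_distrib]
    refine sum_congr rfl fun i _ => ?_
    rw [mulVec, dotProduct, mul_sum, eq_sub_iff_add_eq,
      ← add_sum_erase _ _ (mem_univ i), ← add_sum_erase _ (fun j => w i * w j) (mem_univ i)]
    have : ∑ j ∈ univ.erase i, w i * (G.adjMatrix ℝ i j * w j) =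
        ∑ j ∈ univ.erase i, w i * w j := by
      refine sum_congr rfl fun j hj => ?_
      by_cases hi : w i = 0
      · simp [hi]
      by_cases hj' : w j = 0
      · simp [hj']
      have : G.Adj i j := hc (by simp [hs, hi]) (by simp [hs, hj']) (ne_of_mem_erase hj).symm
      simp [adjMatrix_apply, this]
    rw [this]
    simp
    ring
  have hsum : ∑ v, w v = ∑ v ∈ s, w v := by
    rw [hs, sum_filter_ne_zero]
  have hsq : ∑ v ∈ s, w v ^ 2 ≤ ∑ v, w v ^ 2 :=
    sum_le_sum_of_subset_of_nonneg (subset_univ _) fun _ _ _ => sq_nonneg _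
  have hcard : (#s : ℝ) ≤ G.cliqueNum := by exact_mod_cast hc.card_le_cliqueNum
  have hcs : (∑ v, w v) ^ 2 ≤ G.cliqueNum * ∑ v, w v ^ 2 := by
    rw [hsum]
    calc _ ≤ (#s : ℝ) * ∑ v ∈ s, w v ^ 2 := sq_sum_le_card_mul_sum_sq
      _ ≤ _ := by gcongr
  have : (∑ v, w v) ^ 2 / G.cliqueNum ≤ ∑ v, w v ^ 2 := by
    rw [div_le_iff₀ (by linarith)]
    linarith
  rw [hform, sub_mul, one_mul, one_div_mul_eq_div]
  linarith

/-- Moving all the weight of a vertex to a nonadjacent vertex that sees at least as much weight does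
not decrease the adjacency form. -/
theorem exists_shift_of_not_isClique {w : V → ℝ} (hw : 0 ≤ w)
    (hc : ¬ G.IsClique ({v | w v ≠ 0} : Finset V)) :
    ∃ w' : V → ℝ, 0 ≤ w' ∧ ∑ v, w' v = ∑ v, w v ∧
      w ⬝ᵥ G.adjMatrix ℝ *ᵥ w ≤ w' ⬝ᵥ G.adjMatrix ℝ *ᵥ w' ∧
      #{v | w' v ≠ 0} < #{v | w v ≠ 0} := by
  obtain ⟨u, v, hu, hv, huv, hadj, hle⟩ : ∃ u v, w u ≠ 0 ∧ w v ≠ 0 ∧ u ≠ v ∧ ¬ G.Adj u v ∧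
      (G.adjMatrix ℝ *ᵥ w) v ≤ (G.adjMatrix ℝ *ᵥ w) u := by
    simp only [IsClique, Set.Pairwise] at hc
    push Not at hc
    obtain ⟨u, hu, v, hv, huv, hadj⟩ := hc
    rcases le_total ((G.adjMatrix ℝ *ᵥ w) v) ((G.adjMatrix ℝ *ᵥ w) u) with h | h
    · exact ⟨u, v, by simpa using hu, by simpa using hv, huv, hadj, h⟩
    · exact ⟨v, u, by simpa using hv, by simpa using hu, huv.symm, fun h => hadj h.symm, h⟩
  -- Along `w + t d` the form has no quadratic term, as `u` and `v` are nonadjacent, and its slope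
  -- is nonnegative by `hle`; `t = w v` empties `v`.
  set d : V → ℝ := Pi.single u 1 - Pi.single v 1 with hd
  have hsymm : w ⬝ᵥ G.adjMatrix ℝ *ᵥ d = d ⬝ᵥ G.adjMatrix ℝ *ᵥ w := by
    rw [dotProduct_mulVec, ← mulVec_transpose, transpose_adjMatrix, dotProduct_comm]
  have hdw : d ⬝ᵥ G.adjMatrix ℝ *ᵥ w = (G.adjMatrix ℝ *ᵥ w) u - (G.adjMatrix ℝ *ᵥ w) v := by
    rw [hd, sub_dotProduct, single_dotProduct, single_dotProduct, one_mul, one_mul]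
  have hdd : d ⬝ᵥ G.adjMatrix ℝ *ᵥ d = 0 := by
    have hadj' : ¬ G.Adj v u := fun h => hadj h.symm
    rw [hd, sub_dotProduct, mulVec_sub, single_dotProduct, single_dotProduct, mulVec_single_one,
      mulVec_single_one]
    simp [adjMatrix_apply, hadj, hadj']
  have hv0 : w v + w v * d v = 0 := by simp [hd, huv.symm]
  refine ⟨w + w v • d, fun i => ?_, ?_, ?_, ?_⟩
  · have h1 := hw i
    have h2 := hw v
    simp only [Pi.zero_apply] at h1 h2
    by_cases hi : i = v
    · subst hi; simpa using hv0.ge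
    · by_cases hi' : i = u
      · subst hi'; simp [hd, hi]; linarith
      · simpa [hd, hi, hi'] using h1
  · simp [hd, sum_add_distrib, ← mul_sum]
  · rw [mulVec_add, mulVec_smul, add_dotProduct, dotProduct_add, dotProduct_add, smul_dotProduct,
      smul_dotProduct, dotProduct_smul, dotProduct_smul, hsymm, hdd, hdw]
    simp only [smul_eq_mul, mul_zero, add_zero]
    have := mul_nonneg (hw v) (sub_nonneg.mpr hle)
    linarith
  · refine card_lt_card ⟨fun i => ?_, fun h => ?_⟩
    · simp only [mem_filter, mem_univ, true_and, Pi.add_apply, Pi.smul_apply, smul_eq_mul]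
      contrapose!
      intro hi
      have hiu : i ≠ u := fun h => hu (h ▸ hi)
      have hiv : i ≠ v := fun h => hv (h ▸ hi)
      simp [hd, hi, hiu, hiv]
    · have := h (x := v) (by simp [hv])
      simp only [mem_filter, mem_univ, true_and, Pi.add_apply, Pi.smul_apply, smul_eq_mul] at this
      exact this hv0

/-- The **Motzkin–Straus inequality**. -/
theorem dotProduct_adjMatrix_mulVec_le [Nonempty V] {w : V → ℝ} (hw : 0 ≤ w) :
    w ⬝ᵥ G.adjMatrix ℝ *ᵥ w ≤ (1 - 1 / (G.cliqueNum : ℝ)) * (∑ v, w v) ^ 2 := by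
  induction h : #{v | w v ≠ 0} using Nat.strong_induction_on generalizing w with
  | _ k ih =>
    by_cases hc : G.IsClique ({v | w v ≠ 0} : Finset V)
    · exact G.dotProduct_adjMatrix_mulVec_le_of_isClique hc
    · obtain ⟨w', hw', hsum, hle, hlt⟩ := G.exists_shift_of_not_isClique hw hc
      rw [← hsum]
      exact hle.trans (ih _ (h ▸ hlt) hw' rfl)

/-- The Motzkin–Straus inequality for the nonadjacency form, summed over the positive and the
negative part of a weight. -/
theorem sum_nonadj_mul_add_abs_ge [Nonempty V] (s : V → ℝ) :
    1 / (G.cliqueNum : ℝ) * ((∑ i, s i) ^ 2 + (∑ i, |s i|) ^ 2) ≤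
      ∑ i, ∑ j, (1 - G.adjMatrix ℝ i j) * (s i * s j + |s i| * |s j|) := by
  have key : ∀ w : V → ℝ, 0 ≤ w → 1 / (G.cliqueNum : ℝ) * (∑ i, w i) ^ 2 ≤
      ∑ i, ∑ j, (1 - G.adjMatrix ℝ i j) * (w i * w j) := by
    intro w hw
    have h := G.dotProduct_adjMatrix_mulVec_le hw
    have e : ∑ i, ∑ j, (1 - G.adjMatrix ℝ i j) * (w i * w j) =
        (∑ i, w i) ^ 2 - w ⬝ᵥ G.adjMatrix ℝ *ᵥ w := by
      simp only [sq, sum_mul_sum, dotProduct, mulVec]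
      simp only [mul_sum, ← sum_sub_distrib]
      exact sum_congr rfl fun i _ => sum_congr rfl fun j _ => by ring
    rw [e]
    linarith
  -- `|s| ± s` are twice the positive and negative parts; the mixed terms cancel in the sum.
  have hp := key (fun i => |s i| + s i) fun i => by
    have := neg_abs_le (s i)
    simp only [Pi.zero_apply]; linarith
  have hn := key (fun i => |s i| - s i) fun i => by
    have := le_abs_self (s i)
    simp only [Pi.zero_apply]; linarith
  have e : ∑ i, ∑ j, (1 - G.adjMatrix ℝ i j) * ((|s i| + s i) * (|s j| + s j)) +
      ∑ i, ∑ j, (1 - G.adjMatrix ℝ i j) * ((|s i| - s i) * (|s j| - s j)) =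
      2 * ∑ i, ∑ j, (1 - G.adjMatrix ℝ i j) * (s i * s j + |s i| * |s j|) := by
    simp only [mul_sum, ← sum_add_distrib]
    exact sum_congr rfl fun i _ => sum_congr rfl fun j _ => by ring
  rw [sum_add_distrib] at hp
  rw [sum_sub_distrib] at hn
  linarith

end SimpleGraph

/-! ### Four directions in the plane -/

/-- The four functionals `p`, `q`, `(p + q) / √2`, `(p - q) / √2` have absolute values adding up to
at least `2.4` times the Euclidean norm. -/
theorem norm_le_sum_abs_four_directions {p q r : ℝ} (hr : r ^ 2 = p ^ 2 + q ^ 2) :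
    2.4 * r ≤ |p| + |q| + |(p + q) / √2| + |(p - q) / √2| := by
  have h2 : (0 : ℝ) < √2 := by positivity
  have hs : √2 ^ 2 = 2 := Real.sq_sqrt (by norm_num)
  have hmax : √2 * max |p| |q| = |(p + q) / √2| + |(p - q) / √2| := by
    rw [abs_div, abs_div, abs_of_pos h2, ← add_div, eq_div_iff h2.ne',
      show √2 * max |p| |q| * √2 = √2 ^ 2 * max |p| |q| by ring, hs]
    rcases max_cases |p| |q| with ⟨h, h'⟩ | ⟨h, h'⟩ <;> rw [h] <;>
    rcases abs_cases p with ⟨h1, _⟩ | ⟨h1, _⟩ <;> rcases abs_cases q with ⟨h3, _⟩ | ⟨h3, _⟩ <;>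
    rcases abs_cases (p + q) with ⟨h4, _⟩ | ⟨h4, _⟩ <;>
    rcases abs_cases (p - q) with ⟨h5, _⟩ | ⟨h5, _⟩ <;> rw [h4, h5] <;> linarith
  -- On the axes the four terms add up to `(1 + √2) r`, the minimum; rounding `√2` down to `1.4`
  -- gives `2.4`.
  have h14 : (1.4 : ℝ) ≤ √2 := Real.le_sqrt_of_sq_le (by norm_num)
  have hm : 1.4 * max |p| |q| ≤ √2 * max |p| |q| := by gcongr
  rw [add_assoc, ← hmax]
  have hp := abs_nonneg p
  have hq := abs_nonneg q
  rw [← sq_abs p, ← sq_abs q] at hr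
  refine le_trans ?_ (add_le_add_right hm _)
  refine abs_le_of_sq_le_sq' ?_ (by positivity) |>.2
  rw [mul_pow, hr]
  rcases max_cases |p| |q| with ⟨h, h'⟩ | ⟨h, h'⟩ <;> rw [h] <;> nlinarith

/-- Cauchy–Schwarz in `ℝ⁴`: the directions form two orthonormal frames, so the squares add up to
twice the squared norm. -/
theorem sum_mul_abs_four_directions_le {p q r p' q' r' : ℝ} (hr : r ^ 2 = p ^ 2 + q ^ 2)
    (hr' : r' ^ 2 = p' ^ 2 + q' ^ 2) (h0 : 0 ≤ r) (h0' : 0 ≤ r') :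
    |p| * |p'| + |q| * |q'| + |(p + q) / √2| * |(p' + q') / √2| +
      |(p - q) / √2| * |(p' - q') / √2| ≤ 2 * (r * r') := by
  have hs : √2 ^ 2 = 2 := Real.sq_sqrt (by norm_num)
  have hexp : ∀ a b : ℝ, |a| ^ 2 + |b| ^ 2 + |(a + b) / √2| ^ 2 + |(a - b) / √2| ^ 2 =
      2 * (a ^ 2 + b ^ 2) := by
    intro a b
    simp only [sq_abs, div_pow, hs]
    ring
  have h1 := hexp p q
  have h2 := hexp p' q'
  rw [← hr] at h1
  rw [← hr'] at h2
  have hcs := Finset.sum_mul_sq_le_sq_mul_sq Finset.univ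
    ![|p|, |q|, |(p + q) / √2|, |(p - q) / √2|] ![|p'|, |q'|, |(p' + q') / √2|, |(p' - q') / √2|]
  simp only [Fin.sum_univ_four, Matrix.cons_val] at hcs
  rw [h1, h2] at hcs
  exact abs_le_of_sq_le_sq' (hcs.trans (by ring_nf; rfl)) (by positivity) |>.2

/-! ### The rank-two bound and the eigenvalues -/

namespace SimpleGraph

open Matrix Finset

variable {V : Type*} [Fintype V] [DecidableEq V] (G : SimpleGraph V) [DecidableRel G.Adj]

/-- A Motzkin–Straus type bound for the entrywise square of a positive semidefinite matrix of rank
at most two. -/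
theorem sum_adjMatrix_mul_gram_sq_le [Nonempty V] (a b : V → ℝ) :
    ∑ i, ∑ j, G.adjMatrix ℝ i j * (a i * a j + b i * b j) ^ 2 ≤
      (1 - 0.72 / (G.cliqueNum : ℝ)) * ∑ i, ∑ j, (a i * a j + b i * b j) ^ 2 := by
  have hs : √2 ^ 2 = 2 := Real.sq_sqrt (by norm_num)
  -- `p + iq = (a + ib)²` and `r` is its modulus; squaring a cosine becomes linear in the doubled
  -- angle, which is `hK`.
  set p : V → ℝ := fun i => a i ^ 2 - b i ^ 2 with hp
  set q : V → ℝ := fun i => 2 * a i * b i with hq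
  set r : V → ℝ := fun i => a i ^ 2 + b i ^ 2 with hr
  have hrpq : ∀ i, r i ^ 2 = p i ^ 2 + q i ^ 2 := fun i => by simp only [hp, hq, hr]; ring
  have hr0 : ∀ i, 0 ≤ r i := fun i => by simp only [hr]; positivity
  have hK : ∀ i j, 4 * (a i * a j + b i * b j) ^ 2 =
      2 * (p i * p j + q i * q j) + 2 * (r i * r j) := fun i j => by simp only [hp, hq, hr]; ring
  have h1 := G.sum_nonadj_mul_add_abs_ge p
  have h2 := G.sum_nonadj_mul_add_abs_ge q
  have h3 := G.sum_nonadj_mul_add_abs_ge fun i => (p i + q i) / √2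
  have h4 := G.sum_nonadj_mul_add_abs_ge fun i => (p i - q i) / √2
  have hupper : ∑ i, ∑ j, (1 - G.adjMatrix ℝ i j) * (p i * p j + |p i| * |p j|) +
      ∑ i, ∑ j, (1 - G.adjMatrix ℝ i j) * (q i * q j + |q i| * |q j|) +
      ∑ i, ∑ j, (1 - G.adjMatrix ℝ i j) * ((p i + q i) / √2 * ((p j + q j) / √2) +
        |(p i + q i) / √2| * |(p j + q j) / √2|) +
      ∑ i, ∑ j, (1 - G.adjMatrix ℝ i j) * ((p i - q i) / √2 * ((p j - q j) / √2) +
        |(p i - q i) / √2| * |(p j - q j) / √2|) ≤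
      ∑ i, ∑ j, (1 - G.adjMatrix ℝ i j) * (4 * (a i * a j + b i * b j) ^ 2) := by
    simp only [← sum_add_distrib]
    refine sum_le_sum fun i _ => sum_le_sum fun j _ => ?_
    have hA : 0 ≤ 1 - G.adjMatrix ℝ i j := by
      rw [adjMatrix_apply]; split_ifs <;> norm_num
    simp only [← mul_add]
    refine mul_le_mul_of_nonneg_left ?_ hA
    have h := sum_mul_abs_four_directions_le (hrpq i) (hrpq j) (hr0 i) (hr0 j)
    have e : (p i + q i) / √2 * ((p j + q j) / √2) + (p i - q i) / √2 * ((p j - q j) / √2) =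
        p i * p j + q i * q j := by
      field_simp
      rw [hs]
      ring
    rw [hK]
    linarith
  have hS : (2.4 * ∑ i, r i) ^ 2 ≤ 4 * ((∑ i, |p i|) ^ 2 + (∑ i, |q i|) ^ 2 +
      (∑ i, |(p i + q i) / √2|) ^ 2 + (∑ i, |(p i - q i) / √2|) ^ 2) := by
    have hle : 2.4 * ∑ i, r i ≤ ∑ i, |p i| + ∑ i, |q i| + ∑ i, |(p i + q i) / √2| +
        ∑ i, |(p i - q i) / √2| := by
      simp only [mul_sum, ← sum_add_distrib]
      exact sum_le_sum fun i _ => norm_le_sum_abs_four_directions (hrpq i)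
    have h0 : 0 ≤ 2.4 * ∑ i, r i := mul_nonneg (by norm_num) (sum_nonneg fun i _ => hr0 i)
    refine (pow_le_pow_left₀ h0 hle 2).trans ?_
    have := sq_sum_le_card_mul_sum_sq (s := univ) (f := ![∑ i, |p i|, ∑ i, |q i|,
      ∑ i, |(p i + q i) / √2|, ∑ i, |(p i - q i) / √2|])
    simpa [Fin.sum_univ_four] using this
  have hT : (∑ i, (p i + q i) / √2) ^ 2 + (∑ i, (p i - q i) / √2) ^ 2 =
      (∑ i, p i) ^ 2 + (∑ i, q i) ^ 2 := by
    rw [← sum_div, ← sum_div, sum_add_distrib, sum_sub_distrib p q, div_pow, div_pow, hs]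
    ring
  have htotal : ∑ i, ∑ j, 4 * (a i * a j + b i * b j) ^ 2 =
      2 * ((∑ i, p i) ^ 2 + (∑ i, q i) ^ 2) + 2 * (∑ i, r i) ^ 2 := by
    simp only [hK]
    simp only [sq, sum_mul_sum]
    simp only [mul_sum, ← sum_add_distrib]
  simp only [sub_mul, one_mul, sum_sub_distrib] at hupper h1 h2 h3 h4
  have hadj : ∑ i, ∑ j, G.adjMatrix ℝ i j * (4 * (a i * a j + b i * b j) ^ 2) =
      4 * ∑ i, ∑ j, G.adjMatrix ℝ i j * (a i * a j + b i * b j) ^ 2 := by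
    simp only [mul_sum]
    exact sum_congr rfl fun i _ => sum_congr rfl fun j _ => by ring
  -- `0.72 = 2.4² / 8`: a factor 4 from Cauchy–Schwarz in `hS`, a factor 2 from `htotal`. The signed
  -- sums have coefficient 2, more than the 1.44 needed.
  have hlower : 0.72 * ∑ i, ∑ j, 4 * (a i * a j + b i * b j) ^ 2 ≤
      ((∑ i, p i) ^ 2 + (∑ i, |p i|) ^ 2) + ((∑ i, q i) ^ 2 + (∑ i, |q i|) ^ 2) +
      ((∑ i, (p i + q i) / √2) ^ 2 + (∑ i, |(p i + q i) / √2|) ^ 2) +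
      ((∑ i, (p i - q i) / √2) ^ 2 + (∑ i, |(p i - q i) / √2|) ^ 2) := by
    rw [htotal]
    have hp0 := sq_nonneg (∑ i, p i)
    have hq0 := sq_nonneg (∑ i, q i)
    rw [mul_pow] at hS
    linarith
  have hlower' := mul_le_mul_of_nonneg_left hlower (a := 1 / (G.cliqueNum : ℝ)) (by positivity)
  have hfour : ∑ i, ∑ j, 4 * (a i * a j + b i * b j) ^ 2 =
      4 * ∑ i, ∑ j, (a i * a j + b i * b j) ^ 2 := by simp only [mul_sum]
  rw [hadj, hfour] at hupper
  rw [hfour] at hlower'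
  have e : 0.72 / (G.cliqueNum : ℝ) = 1 / (G.cliqueNum : ℝ) * 0.72 := by ring
  rw [e]
  linarith

/-- The second largest adjacency eigenvalue of a graph that is not complete is nonnegative. -/
theorem adjEigenvalue_one_nonneg (hG : G ≠ ⊤) :
    0 ≤ G.adjEigenvalue 1 (one_lt_card_of_ne_top hG) := by
  have hcard := one_lt_card_of_ne_top hG
  set hA := G.isHermitian_adjMatrix_real
  set l := G.adjEigenvalue 1 hcard with hl
  -- The index in `V` of the top eigenvalue, under the same equivalence that defines `eigenvalues`
  -- from `eigenvalues₀`.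
  set k₀ : V := Fintype.equivOfCardEq (Fintype.card_fin _) (⟨0, by omega⟩ : Fin (Fintype.card V))
    with hk₀
  obtain ⟨u, v, huv, hadj⟩ : ∃ u v, u ≠ v ∧ ¬ G.Adj u v := by
    by_contra! h
    exact hG (by ext u v; exact ⟨fun h => h.ne, fun h' => h u v h'⟩)
  -- On two nonadjacent vertices the form vanishes, and two coordinates leave room for orthogonality
  -- to one eigenvector. A negative `l` would make the form negative at `f`.
  obtain ⟨f, hf0, hff, hfx⟩ : ∃ f : V → ℝ, f ⬝ᵥ G.adjMatrix ℝ *ᵥ f = 0 ∧ 0 < f ⬝ᵥ f ∧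
      ⇑(hA.eigenvectorBasis k₀) ⬝ᵥ f = 0 := by
    generalize (⇑(hA.eigenvectorBasis k₀) : V → ℝ) = x
    obtain ⟨c, d, hcd, hx⟩ : ∃ c d : ℝ, 0 < c * c + d * d ∧ x u * c + x v * d = 0 := by
      by_cases h : x u = 0
      · exact ⟨1, 0, by norm_num, by simp [h]⟩
      · exact ⟨x v, -x u, by have := mul_self_pos.mpr h; nlinarith [mul_self_nonneg (x v)], by ring⟩
    have hadj' : ¬ G.Adj v u := fun h => hadj h.symm
    refine ⟨Pi.single u c + Pi.single v d, ?_, ?_, ?_⟩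
    · simp [mulVec_add, add_dotProduct, adjMatrix_apply, hadj, hadj']
    · simpa [add_dotProduct, huv, huv.symm] using hcd
    · simpa using hx
  by_contra! hneg
  have h1 := hA.dotProduct_mulVec_eq_sum f
  have h2 := hA.dotProduct_self_eq_sum_sq f
  have h3 : f ⬝ᵥ G.adjMatrix ℝ *ᵥ f ≤ l * (f ⬝ᵥ f) := by
    rw [h1, h2, mul_sum]
    refine sum_le_sum fun k _ => ?_
    by_cases hk : k = k₀
    · simp [hk, hfx]
    · refine mul_le_mul_of_nonneg_right ?_ (sq_nonneg _)
      refine hA.eigenvalues₀_antitone ?_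
      rw [Fin.le_def, Nat.one_le_iff_ne_zero]
      intro h
      exact hk ((Equiv.symm_apply_eq _).mp (Fin.ext h))
  nlinarith

/-- For two orthonormal eigenvectors with nonnegative eigenvalues, the sum of the squares of the
eigenvalues is at most `(1 - 0.72 / ω) * 2m`. -/
theorem sq_add_sq_le_of_eigenvectors [Nonempty V] {x y : V → ℝ} {l₁ l₂ : ℝ} (h₁ : 0 ≤ l₁)
    (h₂ : 0 ≤ l₂) (hx : G.adjMatrix ℝ *ᵥ x = l₁ • x) (hy : G.adjMatrix ℝ *ᵥ y = l₂ • y)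
    (hxx : x ⬝ᵥ x = 1) (hyy : y ⬝ᵥ y = 1) (hxy : x ⬝ᵥ y = 0) :
    l₁ ^ 2 + l₂ ^ 2 ≤ (1 - 0.72 / (G.cliqueNum : ℝ)) * (2 * (#G.edgeFinset : ℝ)) := by
  have hω : (1 : ℝ) ≤ G.cliqueNum := by exact_mod_cast G.one_le_cliqueNum
  have hcoef : 0 ≤ 1 - 0.72 / (G.cliqueNum : ℝ) := by
    rw [sub_nonneg, div_le_one (by linarith)]
    linarith
  set M : V → V → ℝ := fun i j => l₁ * (x i * x j) + l₂ * (y i * y j) with hM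
  have hgram : ∀ i j, M i j = √l₁ * x i * (√l₁ * x j) + √l₂ * y i * (√l₂ * y j) := fun i j => by
    have e₁ := Real.mul_self_sqrt h₁
    have e₂ := Real.mul_self_sqrt h₂
    simp only [hM]
    linear_combination -(x i * x j) * e₁ - (y i * y j) * e₂
  have hAM : ∑ i, ∑ j, G.adjMatrix ℝ i j * M i j = l₁ ^ 2 + l₂ ^ 2 := by
    have e : ∑ i, ∑ j, G.adjMatrix ℝ i j * M i j =
        l₁ * (x ⬝ᵥ G.adjMatrix ℝ *ᵥ x) + l₂ * (y ⬝ᵥ G.adjMatrix ℝ *ᵥ y) := by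
      simp only [dotProduct, mulVec, mul_sum, ← sum_add_distrib]
      exact sum_congr rfl fun i _ => sum_congr rfl fun j _ => by simp only [hM]; ring
    rw [e, hx, hy, dotProduct_smul, dotProduct_smul, hxx, hyy]
    simp only [smul_eq_mul]
    ring
  have hMM : ∑ i, ∑ j, M i j ^ 2 = l₁ ^ 2 + l₂ ^ 2 := by
    have e : ∑ i, ∑ j, M i j ^ 2 = l₁ ^ 2 * (x ⬝ᵥ x * x ⬝ᵥ x) + l₂ ^ 2 * (y ⬝ᵥ y * y ⬝ᵥ y) +
        2 * l₁ * l₂ * (x ⬝ᵥ y * x ⬝ᵥ y) := by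
      simp only [dotProduct, sum_mul_sum]
      simp only [mul_sum, ← sum_add_distrib]
      exact sum_congr rfl fun i _ => sum_congr rfl fun j _ => by simp only [hM]; ring
    rw [e, hxx, hyy, hxy]
    ring
  have hAMM := G.sum_adjMatrix_mul_gram_sq_le (fun i => √l₁ * x i) fun i => √l₂ * y i
  simp only [← hgram] at hAMM
  rw [hMM] at hAMM
  have hcs : (l₁ ^ 2 + l₂ ^ 2) ^ 2 ≤
      2 * (#G.edgeFinset : ℝ) * ∑ i, ∑ j, G.adjMatrix ℝ i j * M i j ^ 2 := by
    -- As `A` has entries 0 and 1, `A M = A (A M)` entrywise, so only edges enter either factor.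
    have h := sum_mul_sq_le_sq_mul_sq univ (fun t : V × V => G.adjMatrix ℝ t.1 t.2)
      fun t => G.adjMatrix ℝ t.1 t.2 * M t.1 t.2
    have hidem : ∀ i j, G.adjMatrix ℝ i j * G.adjMatrix ℝ i j = G.adjMatrix ℝ i j := fun i j => by
      rw [adjMatrix_apply]; split_ifs <;> norm_num
    have e₁ : ∀ i j, G.adjMatrix ℝ i j ^ 2 = G.adjMatrix ℝ i j := fun i j => by rw [sq, hidem]
    simp only [← mul_assoc, hidem, mul_pow, e₁, Fintype.sum_prod_type] at h
    rwa [hAM, sum_adjMatrix_eq_two_mul_card_edgeFinset] at h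
  rcases (by positivity : 0 ≤ l₁ ^ 2 + l₂ ^ 2).eq_or_lt with h0 | hpos
  · rw [← h0]
    positivity
  · refine le_of_mul_le_mul_right ?_ hpos
    have := mul_le_mul_of_nonneg_left hAMM (a := 2 * (#G.edgeFinset : ℝ)) (by positivity)
    nlinarith

end SimpleGraph

theorem theorem2 {V : Type*} [Fintype V] [DecidableEq V] (G : SimpleGraph V)
    [DecidableRel G.Adj] (hG : G ≠ ⊤) (C : ℝ)
    (hC : C = 1 + (Real.pi ^ 2 - 4) / (Real.pi ^ 2 + 4)) :
    G.adjEigenvalue 0 (zero_lt_one.trans (SimpleGraph.one_lt_card_of_ne_top hG)) ^ 2 +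
        G.adjEigenvalue 1 (SimpleGraph.one_lt_card_of_ne_top hG) ^ 2 ≤
      (1 - 1 / (C * (G.cliqueNum : ℝ))) * (2 * (G.edgeFinset.card : ℝ)) := by
  have hcard := SimpleGraph.one_lt_card_of_ne_top hG
  have : Nonempty V := Fintype.card_pos_iff.mp (zero_lt_one.trans hcard)
  set hA := G.isHermitian_adjMatrix_real
  have h₂ := G.adjEigenvalue_one_nonneg hG
  have h₁ : 0 ≤ G.adjEigenvalue 0 (zero_lt_one.trans hcard) :=
    h₂.trans (hA.eigenvalues₀_antitone (by simp))
  let e : Fin (Fintype.card V) ≃ V := Fintype.equivOfCardEq (Fintype.card_fin _)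
  have hval : ∀ k : Fin (Fintype.card V), hA.eigenvalues (e k) = hA.eigenvalues₀ k := fun k => by
    simp [Matrix.IsHermitian.eigenvalues, e]
  have hvec : ∀ k : Fin (Fintype.card V), (G.adjMatrix ℝ).mulVec ⇑(hA.eigenvectorBasis (e k)) =
      hA.eigenvalues₀ k • ⇑(hA.eigenvectorBasis (e k)) := fun k => by
    rw [← hval, hA.mulVec_eigenvectorBasis]
  refine (G.sq_add_sq_le_of_eigenvectors h₁ h₂ (hvec _) (hvec _) (by
    simp [hA.eigenvectorBasis_dotProduct]) (by simp [hA.eigenvectorBasis_dotProduct]) (by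
    simp [hA.eigenvectorBasis_dotProduct])).trans ?_
  refine mul_le_mul_of_nonneg_right (sub_le_sub_left ?_ 1) (by positivity)
  have hpi := Real.pi_gt_d2
  have hpi2 : 3.14 ^ 2 ≤ Real.pi ^ 2 := by gcongr
  -- `1 / C = 1/2 + 2/π²`, so `π² ≥ 3.14²` suffices.
  have hCinv : 1 / C ≤ 0.72 := by
    have hC' : C = 2 * Real.pi ^ 2 / (Real.pi ^ 2 + 4) := by
      rw [hC]
      field_simp
      ring
    rw [hC', one_div_div, div_le_iff₀ (by positivity)]
    linarith
  rw [← div_div]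
  gcongr
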